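/- Manifolds are smooth ($C^\infty$), finite-dimensional and without boundary; they need be neither Hausdorff nor second countable. Let $G$ be a separable (real, finite-dimensional) Lie group acting smoothly on a manifold $X$, let $x \in X$, and let $G_x$ be the stabilizer of $x$. Give the orbit $Gx$ the quotient topology of $G/G_x$, transported along the canonical bijection $G/G_x \to Gx$, $\xi G_x \mapsto \xi x$. Then: (a) $Gx$ with this topology has the structure of a manifold for which the orbital map $G \to Gx$, $\xi \mapsto \xi x$, is a smooth submersion (that is, the smooth structure of the homogeneous space $G/G_x$; it is unique). (b) With this structure, $Gx$ is a weakly embedded submanifold of $X$: the inclusion $Gx \to X$ is an injective smooth immersion, and for every manifold $S$, every smooth map $g : S \to X$ with $g(S) \subseteq Gx$ is smooth as a map $S \to Gx$. -/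

import Mathlib

open scoped Manifold ContDiff

universe u v

section WeaklyEmbedded

variable (F : Type*) [NormedAddCommGroup F] [NormedSpace ℝ F]
  (E : Type*) [NormedAddCommGroup E] [NormedSpace ℝ E]
  {Y : Type*} [TopologicalSpace Y] [ChartedSpace F Y]
  {X : Type*} [TopologicalSpace X] [ChartedSpace E X]

/-- Here `F` and `E` are the model spaces of `Y` and `X`. The inclusion `ι : Y → X` presents the manifold `Y`, which carries its own topology and its own
smooth structure, as an immersed submanifold of the manifold `X`: it is injective (so that `Y` is a
subset of `X`) and a smooth immersion. -/
structure IsImmersedSubmanifold (ι : Y → X) : Prop where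
  injective : Function.Injective ι
  isImmersion : Manifold.IsImmersion 𝓘(ℝ, F) 𝓘(ℝ, E) ∞ ι

/-- An immersed submanifold `ι : Y → X` is weakly embedded if every smooth map `g : S → X` of a
manifold `S` into `X` with image in `Y` induces a smooth map `S → Y`. Manifolds are smooth,
finite-dimensional, without boundary, and neither Hausdorff nor second countable in general.
The universes `u` and `v` are those of `S` and of its model space. -/
structure IsWeaklyEmbedded (ι : Y → X) : Prop extends IsImmersedSubmanifold F E ι where
  lift : ∀ {V : Type v} [NormedAddCommGroup V] [NormedSpace ℝ V] [FiniteDimensional ℝ V]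
    {S : Type u} [TopologicalSpace S] [ChartedSpace V S] [IsManifold 𝓘(ℝ, V) ∞ S] (g : S → X),
    ContMDiff 𝓘(ℝ, V) 𝓘(ℝ, E) ∞ g → (∀ s, g s ∈ Set.range ι) →
      ∃ h : S → Y, ι ∘ h = g ∧ ContMDiff 𝓘(ℝ, V) 𝓘(ℝ, F) ∞ h

end WeaklyEmbedded

section Orbit

variable (G : Type*) [Group G] {X : Type*} [MulAction G X] (x : X)

/-- The orbit `Gx` as a type of its own. It is the subtype of `X` given by `MulAction.orbit G x`,
but it does not carry the subspace topology (see the instance below). -/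
def OrbitSpace : Type _ := MulAction.orbit G x

namespace OrbitSpace

/-- The inclusion `Gx → X`. -/
def incl : OrbitSpace G x → X := Subtype.val

/-- The orbital map `G → Gx`, `ξ ↦ ξ x`. -/
def orbitMap : G → OrbitSpace G x := fun ξ => ⟨ξ • x, MulAction.mem_orbit x ξ⟩

/-- The canonical bijection `G / G_x → Gx`, `ξ G_x ↦ ξ x`. -/
noncomputable def equivQuotient : (G ⧸ MulAction.stabilizer G x) ≃ OrbitSpace G x :=
  (MulAction.orbitEquivQuotientStabilizer G x).symm

theorem equivQuotient_mk (ξ : G) :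
    equivQuotient G x (QuotientGroup.mk ξ) = orbitMap G x ξ :=
  Subtype.ext (MulAction.orbitEquivQuotientStabilizer_symm_apply G x ξ)

/-- The topology of the orbit: the quotient topology of `G / G_x`, transported along the canonical
bijection `G / G_x → Gx`. -/
noncomputable instance [TopologicalSpace G] : TopologicalSpace (OrbitSpace G x) :=
  TopologicalSpace.coinduced (equivQuotient G x) inferInstance

end OrbitSpace

/-- The given charts on the orbit `Gx` (with the topology of `G / G_x`) define the smooth structure
that comes from `G / G_x`; here `E` and `F` are the model spaces of `G` and of `Gx`. The smooth structure of the homogeneous space `G / G_x` is the one for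
which the projection `G → G / G_x` is a smooth submersion (there is at most one such structure,
since the projection is onto); transported along `G / G_x → Gx`, this says that the orbital map
`G → Gx` is a smooth submersion. -/
structure IsOrbitStructure (E : Type*) [NormedAddCommGroup E] [NormedSpace ℝ E]
    (F : Type*) [NormedAddCommGroup F] [NormedSpace ℝ F]
    [TopologicalSpace G] [ChartedSpace E G] [ChartedSpace F (OrbitSpace G x)] :
    Prop where
  isManifold : IsManifold 𝓘(ℝ, F) ∞ (OrbitSpace G x)
  isSubmersion : Manifold.IsSubmersion 𝓘(ℝ, E) 𝓘(ℝ, F) ∞ (OrbitSpace.orbitMap G x)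

end Orbit

/-!
Let `φ : G → X`, `ξ ↦ ξ x`, be the orbital map and let `W` be a space of the dimension of the image
of `dφ` at `1`. Choose a transversal `N` to that image in a chart of `X`, and a smooth map
`sect : W → G` whose composite with `φ` has differential an isomorphism onto the image. By the
inverse function theorem `(w, t) ↦ sect w • t` parametrises a neighbourhood of `x`; its inverse is
a slice chart (`exists_orbitSlice`) with coordinates in `W × N`.

The whole argument rests on one fact: the transversal coordinate `g ↦ t (g x)` is locally constant
on the open set of `G` where it is defined (`OrbitSlice.eventually_coord_snd_eq`). Indeed by
equivariance `dφ` has rank `dim W` everywhere; in the slice chart its image contains `W`, because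
`w ↦ sect w` moves points along `W` only; so the image is `W` and `d t` vanishes. This replaces the
closed subgroup theorem and the constant rank theorem.

Consequently the part of the orbit with `t = 0` is open for the topology of `G / G_x`, and `w` is a
chart on it with inverse `w ↦ sect w • x` (`OrbitSlice.orbitChart`). The translates of this chart by
elements of `G` form a smooth atlas, since the chart changes are composites of smooth maps through
`X`, and the orbital map is a submersion because `d w` is onto.

For an arbitrary structure making the orbital map a submersion, these charts are smooth in both
directions, by means of local sections of the submersion; in them the inclusion is `w ↦ (w, 0)`, so
it is an immersion. If moreover `G` is separable, `t` takes only countably many values on the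
orbit. A continuous map into `X` with values in the orbit therefore has locally constant transversal
coordinate, and is locally given by its `w`-coordinate, which is smooth
(`OrbitSlice.contMDiff_of_incl_comp`).
-/

open Set Filter Topology

/-! ### Inverse functions, local constancy and local sections -/

section InverseFunction

/-- The inverse function theorem for `C^∞` maps on an open set, with a smooth inverse on the whole
target (and not merely at the image point). -/
theorem ContDiffOn.exists_openPartialHomeomorph {E F : Type*}
    [NormedAddCommGroup E] [NormedSpace ℝ E] [CompleteSpace E]
    [NormedAddCommGroup F] [NormedSpace ℝ F] {f : E → F} {U : Set E} (hU : IsOpen U)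
    (hf : ContDiffOn ℝ ∞ f U) {a : E} (ha : a ∈ U) (A : E ≃L[ℝ] F)
    (hA : HasFDerivAt f (A : E →L[ℝ] F) a) :
    ∃ e : OpenPartialHomeomorph E F, a ∈ e.source ∧ e.source ⊆ U ∧ ⇑e = f ∧
      ContDiffOn ℝ ∞ e.symm e.target := by
  have hfa : ContDiffAt ℝ ∞ f a := hf.contDiffAt (hU.mem_nhds ha)
  -- The inverse is `C^∞` wherever the derivative is invertible, which is an open condition.
  -- Smoothness of the inverse at `f a` alone would only give `C^m` near `f a`, for each finite `m`.
  have hD : ContinuousOn (fderiv ℝ f) U := hf.continuousOn_fderiv_of_isOpen hU (by simp)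
  obtain ⟨V, hVsub, hV, haV⟩ : ∃ V ⊆ U ∩ fderiv ℝ f ⁻¹'
      range (ContinuousLinearEquiv.toContinuousLinearMap : (E ≃L[ℝ] F) → _), IsOpen V ∧ a ∈ V := by
    refine mem_nhds_iff.1 (inter_mem (hU.mem_nhds ha) ?_)
    refine (hD.continuousAt (hU.mem_nhds ha)).preimage_mem_nhds ?_
    rw [hA.fderiv]
    exact A.nhds
  let e := (hfa.toOpenPartialHomeomorph f hA (by simp)).restr V
  have hes : e.source ⊆ V := by
    rw [OpenPartialHomeomorph.restr_source, hV.interior_eq]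
    exact inter_subset_right
  refine ⟨e, ?_, fun y hy => (hVsub (hes hy)).1, rfl, fun y hy => ?_⟩
  · rw [OpenPartialHomeomorph.restr_source, hV.interior_eq]
    exact ⟨hfa.mem_toOpenPartialHomeomorph_source hA (by simp), haV⟩
  · have hy' := hVsub (hes (e.map_target hy))
    obtain ⟨B, hB⟩ := hy'.2
    have hfy : ContDiffAt ℝ ∞ f (e.symm y) := hf.contDiffAt (hU.mem_nhds hy'.1)
    refine (e.contDiffAt_symm hy (f₀' := B) ?_ hfy).contDiffWithinAt
    rw [hB]
    exact (hfy.differentiableAt (by simp)).hasFDerivAt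

end InverseFunction

section Manifold

variable {E : Type*} [NormedAddCommGroup E] [NormedSpace ℝ E]
  {M : Type*} [TopologicalSpace M] [ChartedSpace E M] [IsManifold 𝓘(ℝ, E) ∞ M]

/-- A smooth map with zero differential is locally constant. -/
theorem ContMDiffOn.eventually_eq_of_mfderiv_eq_zero
    {V : Type*} [NormedAddCommGroup V] [NormedSpace ℝ V]
    {f : M → V} {U : Set M} (hU : IsOpen U)
    (hf : ContMDiffOn 𝓘(ℝ, E) 𝓘(ℝ, V) ∞ f U)
    (h0 : ∀ p ∈ U, mfderiv 𝓘(ℝ, E) 𝓘(ℝ, V) f p = 0) {p : M} (hp : p ∈ U) :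
    ∀ᶠ q in 𝓝 p, f q = f p := by
  set c := chartAt E p with hc
  have hcm : c ∈ IsManifold.maximalAtlas 𝓘(ℝ, E) ∞ M := IsManifold.chart_mem_maximalAtlas p
  have hpc : p ∈ c.source := mem_chart_source E p
  set s : Set E := c.target ∩ c.symm ⁻¹' U with hs
  have hso : IsOpen s := c.isOpen_inter_preimage_symm hU
  have hcs : ContMDiffOn 𝓘(ℝ, E) 𝓘(ℝ, E) ∞ c.symm c.target :=
    contMDiffOn_symm_of_mem_maximalAtlas hcm
  have hder : ∀ v ∈ s, HasFDerivAt (f ∘ c.symm) (0 : E →L[ℝ] V) v := by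
    intro v hv
    have h1 : MDifferentiableAt 𝓘(ℝ, E) 𝓘(ℝ, V) f (c.symm v) :=
      (hf.contMDiffAt (hU.mem_nhds hv.2)).mdifferentiableAt (by simp)
    have h2 : MDifferentiableAt 𝓘(ℝ, E) 𝓘(ℝ, E) c.symm v :=
      (hcs.contMDiffAt (c.open_target.mem_nhds hv.1)).mdifferentiableAt (by simp)
    have h3 := h1.hasMFDerivAt.comp v h2.hasMFDerivAt
    rw [h0 _ hv.2] at h3
    have h4 := hasMFDerivAt_iff_hasFDerivAt.1 h3
    refine h4.congr_fderiv ?_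
    ext; rfl
  have hopen := hso.isOpen_inter_preimage_of_fderiv_eq_zero
    (fun v hv => (hder v hv).differentiableAt.differentiableWithinAt)
    (fun v hv => (hder v hv).fderiv) {f p}
  have hmem : c p ∈ s ∩ (f ∘ c.symm) ⁻¹' {f p} := by
    refine ⟨⟨c.map_source hpc, ?_⟩, ?_⟩ <;> simp [c.left_inv hpc, hp]
  filter_upwards [(c.continuousAt hpc).preimage_mem_nhds (hopen.mem_nhds hmem),
    c.open_source.mem_nhds hpc] with q hq hqs
  have := hq.2
  simpa [c.left_inv hqs] using this

/-- Composing a chart with a local diffeomorphism of vector spaces and a linear isomorphism back to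
the model space gives a chart. -/
theorem trans_mem_maximalAtlas {F : Type*} [NormedAddCommGroup F] [NormedSpace ℝ F]
    {c : OpenPartialHomeomorph M E} (hc : c ∈ IsManifold.maximalAtlas 𝓘(ℝ, E) ∞ M)
    (e : OpenPartialHomeomorph E F) (he : ContDiffOn ℝ ∞ e e.source)
    (hes : ContDiffOn ℝ ∞ e.symm e.target) (A : E ≃L[ℝ] F) :
    (c.trans e).trans A.symm.toHomeomorph.toOpenPartialHomeomorph ∈
      IsManifold.maximalAtlas 𝓘(ℝ, E) ∞ M := by
  set e' := (c.trans e).trans A.symm.toHomeomorph.toOpenPartialHomeomorph with he'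
  have hs : e'.source = c.source ∩ c ⁻¹' e.source := by simp [e']
  have ht : e'.target = A ⁻¹' e.target ∩ (fun v => e.symm (A v)) ⁻¹' c.target := by
    ext v
    simp [e']
  apply OpenPartialHomeomorph.mem_maximalAtlas_of_contMDiffOn
  · have h1 : ContMDiffOn 𝓘(ℝ, E) 𝓘(ℝ, E) ∞ (fun v => A.symm (e v)) e.source :=
      contMDiffOn_iff_contDiffOn.2 (A.symm.contDiff.comp_contDiffOn he)
    exact h1.comp ((contMDiffOn_of_mem_maximalAtlas hc).mono (hs ▸ inter_subset_left))
      (hs ▸ inter_subset_right)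
  · have h1 : ContMDiffOn 𝓘(ℝ, E) 𝓘(ℝ, E) ∞ (fun v => e.symm (A v)) e'.target :=
      contMDiffOn_iff_contDiffOn.2 (hes.comp A.contDiff.contDiffOn (ht ▸ inter_subset_left))
    exact (contMDiffOn_symm_of_mem_maximalAtlas hc).comp h1 (ht ▸ inter_subset_right)

/-- A map onto a vector space that is smooth near `p` with surjective differential at `p` becomes a
linear projection in a suitable chart at `p`; the kernel can be any space of the right dimension. -/
theorem ContMDiffOn.exists_chart_eq_fst [FiniteDimensional ℝ E]
    {W : Type*} [NormedAddCommGroup W] [NormedSpace ℝ W] [FiniteDimensional ℝ W]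
    {K : Type*} [NormedAddCommGroup K] [NormedSpace ℝ K] [FiniteDimensional ℝ K]
    (hdim : Module.finrank ℝ W + Module.finrank ℝ K = Module.finrank ℝ E)
    {f : M → W} {U : Set M} (hU : IsOpen U)
    (hf : ContMDiffOn 𝓘(ℝ, E) 𝓘(ℝ, W) ∞ f U) {p : M} (hp : p ∈ U)
    (hsurj : Function.Surjective (mfderiv 𝓘(ℝ, E) 𝓘(ℝ, W) f p)) :
    ∃ (A : E ≃L[ℝ] (W × K)) (e : OpenPartialHomeomorph M E),
      e ∈ IsManifold.maximalAtlas 𝓘(ℝ, E) ∞ M ∧ p ∈ e.source ∧ e.source ⊆ U ∧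
      ∀ q ∈ e.source, (A (e q)).1 = f q := by
  set c := chartAt E p with hc
  have hcm : c ∈ IsManifold.maximalAtlas 𝓘(ℝ, E) ∞ M := IsManifold.chart_mem_maximalAtlas p
  have hpc : p ∈ c.source := mem_chart_source E p
  have hcs : ContMDiffOn 𝓘(ℝ, E) 𝓘(ℝ, E) ∞ c.symm c.target :=
    contMDiffOn_symm_of_mem_maximalAtlas hcm
  set s : Set E := c.target ∩ c.symm ⁻¹' U with hs
  have hso : IsOpen s := c.isOpen_inter_preimage_symm hU
  have hps : c p ∈ s := ⟨c.map_source hpc, by simp [c.left_inv hpc, hp]⟩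
  let D : E →L[ℝ] W := mfderiv 𝓘(ℝ, E) 𝓘(ℝ, W) f p
  have hfd : MDifferentiableAt 𝓘(ℝ, E) 𝓘(ℝ, W) f p :=
    (hf.contMDiffAt (hU.mem_nhds hp)).mdifferentiableAt (by simp)
  have hD : HasFDerivAt (f ∘ c.symm) D (c p) := by
    have h1 : HasFDerivWithinAt (f ∘ c.symm) D (range 𝓘(ℝ, E)) (c p) := hfd.hasMFDerivAt.2
    simpa using h1
  have hDs : Function.Surjective D := hsurj
  -- Split the model space as image times kernel of `D`, and replace the kernel by `K`.
  have hker : Module.finrank ℝ D.ker = Module.finrank ℝ K := by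
    have h1 := LinearMap.finrank_range_add_finrank_ker (D : E →ₗ[ℝ] W)
    have h2 : Module.finrank ℝ (LinearMap.range (D : E →ₗ[ℝ] W)) = Module.finrank ℝ W := by
      rw [LinearMap.range_eq_top.2 hDs, finrank_top]
    change Module.finrank ℝ (LinearMap.ker (D : E →ₗ[ℝ] W)) = _
    omega
  let k : D.ker ≃L[ℝ] K := ContinuousLinearEquiv.ofFinrankEq hker
  obtain ⟨π, hπ⟩ := Submodule.ClosedComplemented.of_finiteDimensional D.ker
  let P : E →L[ℝ] W × K := D.prod ((k : D.ker →L[ℝ] K).comp π)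
  have hPinj : Function.Injective P := by
    rw [injective_iff_map_eq_zero]
    intro v hv
    have h1 : D v = 0 := congrArg Prod.fst hv
    have h2 : k (π v) = 0 := congrArg Prod.snd hv
    have h3 := hπ ⟨v, h1⟩
    have h4 : π v = 0 := by simpa using h2
    simpa [h4] using (congrArg Subtype.val h3).symm
  let A : E ≃L[ℝ] W × K := (LinearEquiv.ofInjectiveOfFinrankEq (P : E →ₗ[ℝ] W × K) hPinj
    (by rw [Module.finrank_prod, hdim])).toContinuousLinearEquiv
  have hAP : ∀ v, A v = P v := fun v => rfl
  let φ : E → W × K := fun v => (f (c.symm v), k (π v))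
  have hφ : ContDiffOn ℝ ∞ φ s := by
    refine ContDiffOn.prodMk ?_ ?_
    · exact contMDiffOn_iff_contDiffOn.1 (hf.comp (hcs.mono inter_subset_left) fun v hv => hv.2)
    · exact ((k : D.ker →L[ℝ] K).comp π).contDiff.contDiffOn
  have hφ' : HasFDerivAt φ (A : E →L[ℝ] W × K) (c p) := by
    have : (A : E →L[ℝ] W × K) = P := by ext v <;> simp [hAP]
    rw [this]
    exact hD.prodMk ((k : D.ker →L[ℝ] K).comp π).hasFDerivAt
  obtain ⟨e, hpe, hes, hef, hesymm⟩ := hφ.exists_openPartialHomeomorph hso hps A hφ'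
  let e' : OpenPartialHomeomorph M E := (c.trans e).trans A.symm.toHomeomorph.toOpenPartialHomeomorph
  have he's : e'.source = c.source ∩ c ⁻¹' e.source := by
    simp [e']
  have he'a : ∀ q, e' q = A.symm (e (c q)) := fun q => rfl
  refine ⟨A, e', trans_mem_maximalAtlas hcm e (hef ▸ hφ.mono hes) hesymm A, ?_, ?_, ?_⟩
  · rw [he's]; exact ⟨hpc, hpe⟩
  · intro q hq
    rw [he's] at hq
    have := (hes hq.2).2
    simpa [c.left_inv hq.1] using this
  · intro q hq
    rw [he's] at hq
    simp [he'a, hef, φ, c.left_inv hq.1]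

omit [IsManifold 𝓘(ℝ, E) ∞ M] in
/-- A submersion has smooth local sections. -/
theorem Manifold.IsSubmersionAt.exists_section
    {F : Type*} [NormedAddCommGroup F] [NormedSpace ℝ F]
    {Y : Type*} [TopologicalSpace Y] [ChartedSpace F Y]
    {q : M → Y} {p : M} (h : Manifold.IsSubmersionAt 𝓘(ℝ, E) 𝓘(ℝ, F) ∞ q p) :
    ∃ σ : Y → M, σ (q p) = p ∧ ContMDiffAt 𝓘(ℝ, F) 𝓘(ℝ, E) ∞ σ (q p) ∧
      ∀ᶠ y in 𝓝 (q p), q (σ y) = y := by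
  set d := h.domChart
  set c := h.codChart
  have hpd : p ∈ d.source := h.mem_domChart_source
  have hpc : q p ∈ c.source := h.mem_codChart_source
  have hw : ∀ v ∈ d.target, c (q (d.symm v)) = (h.equiv v).1 := by
    intro v hv
    have := h.writtenInCharts (show v ∈ (d.extend 𝓘(ℝ, E)).target by simpa using hv)
    simpa using this
  have h0 : c (q p) = (h.equiv (d p)).1 := by
    simpa [d.left_inv hpd] using hw (d p) (d.map_source hpd)
  let τ : Y → E := fun y => h.equiv.symm (c y, (h.equiv (d p)).2)
  have hτ0 : τ (q p) = d p := by simp [τ, h0]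
  have hc : ContMDiffAt 𝓘(ℝ, F) 𝓘(ℝ, F) ∞ c (q p) :=
    contMDiffAt_of_mem_maximalAtlas h.codChart_mem_maximalAtlas hpc
  have hτ : ContMDiffAt 𝓘(ℝ, F) 𝓘(ℝ, E) ∞ τ (q p) := by
    have h1 : ContDiff ℝ ∞ fun w : F => h.equiv.symm (w, (h.equiv (d p)).2) :=
      h.equiv.symm.contDiff.comp (contDiff_id.prodMk contDiff_const)
    exact (h1.contMDiff _).comp (q p) hc
  have hmem : ∀ᶠ y in 𝓝 (q p), τ y ∈ d.target :=
    hτ.continuousAt.preimage_mem_nhds (by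
      rw [hτ0]; exact d.open_target.mem_nhds (d.map_source hpd))
  refine ⟨d.symm ∘ τ, by simp [hτ0, d.left_inv hpd], ?_, ?_⟩
  · refine ContMDiffAt.comp (I' := 𝓘(ℝ, E)) (q p) ?_ hτ
    exact contMDiffAt_symm_of_mem_maximalAtlas h.domChart_mem_maximalAtlas
      (by rw [hτ0]; exact d.map_source hpd)
  · filter_upwards [hmem, c.open_source.mem_nhds hpc] with y hy hyc
    have h1 := hw _ hy
    have h2 : q (d.symm (τ y)) ∈ c.source := h.source_subset_preimage_source (d.map_target hy)
    refine c.injOn h2 hyc ?_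
    simpa [τ] using h1

omit [IsManifold 𝓘(ℝ, E) ∞ M] in
/-- A map out of the target of a submersion is smooth where its composite with the submersion is. -/
theorem Manifold.IsSubmersionAt.contMDiffAt_of_comp
    {F : Type*} [NormedAddCommGroup F] [NormedSpace ℝ F]
    {Y : Type*} [TopologicalSpace Y] [ChartedSpace F Y]
    {V : Type*} [NormedAddCommGroup V] [NormedSpace ℝ V]
    {Z : Type*} [TopologicalSpace Z] [ChartedSpace V Z]
    {q : M → Y} {p : M} (h : Manifold.IsSubmersionAt 𝓘(ℝ, E) 𝓘(ℝ, F) ∞ q p) {f : Y → Z}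
    (hf : ContMDiffAt 𝓘(ℝ, E) 𝓘(ℝ, V) ∞ (f ∘ q) p) :
    ContMDiffAt 𝓘(ℝ, F) 𝓘(ℝ, V) ∞ f (q p) := by
  obtain ⟨σ, hσ, hσs, hσq⟩ := h.exists_section
  have h1 : ContMDiffAt 𝓘(ℝ, F) 𝓘(ℝ, V) ∞ ((f ∘ q) ∘ σ) (q p) := by
    refine ContMDiffAt.comp (I' := 𝓘(ℝ, E)) (q p) ?_ hσs
    rwa [hσ]
  refine h1.congr_of_eventuallyEq ?_
  filter_upwards [hσq] with y hy
  simp [hy]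

end Manifold

/-! ### Slice charts adapted to a group action -/

section Slice

variable (E : Type*) [NormedAddCommGroup E] [NormedSpace ℝ E]
  (E' : Type*) [NormedAddCommGroup E'] [NormedSpace ℝ E']
  (G : Type*) [TopologicalSpace G] [ChartedSpace E G] [Group G]
  {X : Type*} [TopologicalSpace X] [ChartedSpace E' X] [MulAction G X]

/-- The differential at `1` of the orbital map `G → X`, `ξ ↦ ξ x`, as a map between the model
spaces. -/
noncomputable def orbitDeriv (x : X) : E →L[ℝ] E' :=
  mfderiv 𝓘(ℝ, E) 𝓘(ℝ, E') (fun g : G => g • x) 1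

/-- A chart of `X` centred at `x`, with values split as `W × N`, that is adapted to the action of
`G`: the point with coordinates `(w, t)` is `sect w • transversal t`, where `sect : W → G` is smooth
on the open set `dom` and `transversal : N → X` parametrises a transversal to the orbit of `x`. The
chart takes values in the model space of `X`, which `split` identifies with `W × N`. The condition on
the rank says that `W` has the dimension of the tangent space of the orbit. -/
structure OrbitSlice (x : X) (W N : Type*) [NormedAddCommGroup W] [NormedSpace ℝ W]
    [NormedAddCommGroup N] [NormedSpace ℝ N] where
  chart : OpenPartialHomeomorph X E'
  split : E' ≃L[ℝ] W × N
  dom : Set W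
  sect : W → G
  transversal : N → X
  chart_mem : chart ∈ IsManifold.maximalAtlas 𝓘(ℝ, E') ∞ X
  mem_source : x ∈ chart.source
  chart_base : chart x = 0
  isOpen_dom : IsOpen dom
  contMDiffOn_sect : ContMDiffOn 𝓘(ℝ, W) 𝓘(ℝ, E) ∞ sect dom
  transversal_zero : transversal 0 = x
  mem_dom : ∀ v ∈ chart.target, (split v).1 ∈ dom
  symm_apply : ∀ v ∈ chart.target, chart.symm v = sect (split v).1 • transversal (split v).2
  rank_eq : Module.finrank ℝ W = Module.finrank ℝ (orbitDeriv E E' G x).range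

variable [LieGroup 𝓘(ℝ, E) ∞ G] [IsManifold 𝓘(ℝ, E') ∞ X]
  [ContMDiffSMul 𝓘(ℝ, E) 𝓘(ℝ, E') ∞ G X]

omit [LieGroup 𝓘(ℝ, E) ∞ G] [IsManifold 𝓘(ℝ, E') ∞ X] in
theorem contMDiff_smul_point (x : X) :
    ContMDiff 𝓘(ℝ, E) 𝓘(ℝ, E') ∞ fun g : G => g • x :=
  contMDiff_id.smul contMDiff_const

/-- Slice charts exist: this is the inverse function theorem for `(w, t) ↦ sect w • transversal t`. -/
theorem exists_orbitSlice [FiniteDimensional ℝ E] [FiniteDimensional ℝ E'] (x : X)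
    (W : Type*) [NormedAddCommGroup W] [NormedSpace ℝ W] [FiniteDimensional ℝ W]
    (hW : Module.finrank ℝ W = Module.finrank ℝ (orbitDeriv E E' G x).range) :
    ∃ N : Submodule ℝ E', Nonempty (OrbitSlice E E' G x W N) := by
  have : IsManifold 𝓘(ℝ, E) ∞ G := LieGroup.toContMDiffMul.toIsManifold
  set L := orbitDeriv E E' G x with hL
  set c := chartAt E (1 : G) with hc
  set d := chartAt E' x with hd
  have h1c : (1 : G) ∈ c.source := mem_chart_source E 1
  have hxd : x ∈ d.source := mem_chart_source E' x
  have hdm : d ∈ IsManifold.maximalAtlas 𝓘(ℝ, E') ∞ X := IsManifold.chart_mem_maximalAtlas x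
  have hcs : ContMDiffOn 𝓘(ℝ, E) 𝓘(ℝ, E) ∞ c.symm c.target :=
    contMDiffOn_symm_of_mem_maximalAtlas (IsManifold.chart_mem_maximalAtlas 1)
  have hds : ContMDiffOn 𝓘(ℝ, E') 𝓘(ℝ, E') ∞ d.symm d.target :=
    contMDiffOn_symm_of_mem_maximalAtlas hdm
  have hdo : ContMDiffOn 𝓘(ℝ, E') 𝓘(ℝ, E') ∞ d d.source :=
    contMDiffOn_of_mem_maximalAtlas hdm
  have hLd : HasFDerivAt (fun v => d (c.symm v • x)) L (c 1) := by
    have h0 : MDifferentiableAt 𝓘(ℝ, E) 𝓘(ℝ, E') (fun g : G => g • x) 1 :=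
      (contMDiff_smul_point E E' G x 1).mdifferentiableAt (by simp)
    have h1 : HasFDerivWithinAt (chartAt E' ((1 : G) • x) ∘ (fun g : G => g • x) ∘ c.symm) L
      (range 𝓘(ℝ, E)) (c 1) := h0.hasMFDerivAt.2
    rw [one_smul] at h1
    simpa [Function.comp_def] using h1
  -- `i` identifies `W` with the image of `L`, and `R` is a linear section of `L` over `W`.
  let i : W ≃L[ℝ] L.range := ContinuousLinearEquiv.ofFinrankEq hW
  obtain ⟨R₀, hR₀⟩ := (L : E →ₗ[ℝ] E').rangeRestrict.exists_rightInverse_of_surjective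
    (LinearMap.range_rangeRestrict _)
  let R : W →L[ℝ] E := (LinearMap.toContinuousLinearMap R₀).comp (i : W →L[ℝ] L.range)
  have hR : ∀ w, L (R w) = i w := fun w =>
    congrArg Subtype.val (LinearMap.congr_fun hR₀ (i w))
  obtain ⟨N, hN⟩ := L.range.exists_isCompl
  let A : (W × N) ≃L[ℝ] E' := (i.prodCongr (ContinuousLinearEquiv.refl ℝ N)).trans
    (Submodule.prodEquivOfIsCompl _ N hN).toContinuousLinearEquiv
  have hA : ∀ w t, A (w, t) = (i w : E') + t := fun w t => rfl
  let s : W → G := fun w => c.symm (c 1 + R w)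
  let τ : N → X := fun t => d.symm (d x + t)
  have hs0 : s 0 = 1 := by simp [s, c.left_inv h1c]
  have hτ0 : τ 0 = x := by simp [τ, d.left_inv hxd]
  let domS : Set W := (fun w => c 1 + R w) ⁻¹' c.target
  let domT : Set N := (fun t : N => d x + (t : E')) ⁻¹' d.target
  have hdomS : IsOpen domS := c.open_target.preimage (by fun_prop)
  have hdomT : IsOpen domT := d.open_target.preimage (by fun_prop)
  have hsS : ContMDiffOn 𝓘(ℝ, W) 𝓘(ℝ, E) ∞ s domS := by
    have : ContDiff ℝ ∞ fun w : W => c 1 + R w := contDiff_const.add R.contDiff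
    exact hcs.comp this.contMDiff.contMDiffOn fun _ h => h
  have hτT : ContMDiffOn 𝓘(ℝ, N) 𝓘(ℝ, E') ∞ τ domT := by
    have : ContDiff ℝ ∞ fun t : N => d x + (t : E') := contDiff_const.add N.subtypeL.contDiff
    exact hds.comp this.contMDiff.contMDiffOn fun _ h => h
  let α : W × N → X := fun z => s z.1 • τ z.2
  have hα : ContMDiffOn 𝓘(ℝ, W × N) 𝓘(ℝ, E') ∞ α (domS ×ˢ domT) := by
    refine ContMDiffOn.smul (I := 𝓘(ℝ, E)) (f := fun z : W × N => s z.1)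
      (g := fun z : W × N => τ z.2) ?_ ?_
    · exact hsS.comp contDiff_fst.contMDiff.contMDiffOn fun z hz => hz.1
    · exact hτT.comp contDiff_snd.contMDiff.contMDiffOn fun z hz => hz.2
  set U : Set (W × N) := (domS ×ˢ domT) ∩ α ⁻¹' d.source with hU
  have hUo : IsOpen U := hα.continuousOn.isOpen_inter_preimage (hdomS.prod hdomT) d.open_source
  have h0U : (0 : W × N) ∈ U := by
    refine ⟨⟨?_, ?_⟩, ?_⟩
    · simpa [domS] using c.map_source h1c
    · simpa [domT] using d.map_source hxd
    · simpa [α, hs0, hτ0] using hxd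
  have hψ : ContDiffOn ℝ ∞ (d ∘ α) U :=
    contMDiffOn_iff_contDiffOn.1 (hdo.comp (hα.mono inter_subset_left) inter_subset_right)
  have hψ' : HasFDerivAt (d ∘ α) (A : W × N →L[ℝ] E') 0 := by
    have hD := ((hψ.contDiffAt (hUo.mem_nhds h0U)).differentiableAt (by simp)).hasFDerivAt
    set D := fderiv ℝ (d ∘ α) 0
    have hDW : ∀ w, D (w, 0) = i w := by
      have h1 : HasFDerivAt (fun w : W => (d ∘ α) (w, (0 : N)))
          (D.comp (ContinuousLinearMap.inl ℝ W N)) 0 :=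
        HasFDerivAt.comp (0 : W) (f := fun w : W => (w, (0 : N))) hD
          (ContinuousLinearMap.inl ℝ W N).hasFDerivAt
      have h2 : HasFDerivAt (fun w : W => (d ∘ α) (w, (0 : N))) (L.comp R) 0 := by
        have h3 : HasFDerivAt (fun w : W => c 1 + R w) R 0 := R.hasFDerivAt.const_add _
        have h4 : HasFDerivAt (fun v => d (c.symm v • x)) L (c 1 + R 0) := by simpa using hLd
        have h5 := h4.comp (0 : W) h3
        have h6 : (fun w : W => (d ∘ α) (w, (0 : N))) =
            (fun v => d (c.symm v • x)) ∘ fun w : W => c 1 + R w := by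
          funext w; simp only [Function.comp, α, hτ0, s]
        rw [h6]; exact h5
      intro w
      have := congrArg (fun T : W →L[ℝ] E' => T w) (h1.unique h2)
      simpa [hR] using this
    have hDN : ∀ t : N, D (0, t) = t := by
      have h1 : HasFDerivAt (fun t : N => (d ∘ α) ((0 : W), t))
          (D.comp (ContinuousLinearMap.inr ℝ W N)) 0 :=
        HasFDerivAt.comp (0 : N) (f := fun t : N => ((0 : W), t)) hD
          (ContinuousLinearMap.inr ℝ W N).hasFDerivAt
      have h2 : HasFDerivAt (fun t : N => (d ∘ α) ((0 : W), t)) N.subtypeL 0 := by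
        have h3 : HasFDerivAt (fun t : N => d x + (t : E')) N.subtypeL 0 :=
          N.subtypeL.hasFDerivAt.const_add _
        refine h3.congr_of_eventuallyEq ?_
        filter_upwards [hdomT.mem_nhds h0U.1.2] with t ht
        simp only [Function.comp, α, hs0, one_smul, τ]
        exact d.right_inv ht
      intro t
      have := congrArg (fun T : N →L[ℝ] E' => T t) (h1.unique h2)
      simpa using this
    refine hD.congr_fderiv ?_
    ext z
    · simpa [hA] using hDW z
    · simpa [hA] using hDN z
  obtain ⟨e, h0e, heU, hef, hes⟩ := hψ.exists_openPartialHomeomorph hUo h0U A hψ'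
  let C : OpenPartialHomeomorph X E' :=
    (d.trans e.symm).trans A.symm.symm.toHomeomorph.toOpenPartialHomeomorph
  have hCs : C.source = d.source ∩ d ⁻¹' e.target := by simp [C]
  have hCt : ∀ v ∈ C.target, A.symm v ∈ e.source ∧ e (A.symm v) ∈ d.target := by
    intro v hv
    simpa [C] using hv
  have hd0 : e 0 = d x := by rw [hef]; simp [α, hs0, hτ0]
  refine ⟨N, ⟨{
    chart := C
    split := A.symm
    dom := domS
    sect := s
    transversal := τ
    chart_mem := trans_mem_maximalAtlas hdm e.symm hes (hef ▸ hψ.mono heU) A.symm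
    mem_source := ?_
    chart_base := ?_
    isOpen_dom := hdomS
    contMDiffOn_sect := hsS
    transversal_zero := hτ0
    mem_dom := fun v hv => (heU (hCt v hv).1).1.1
    symm_apply := ?_
    rank_eq := hW }⟩⟩
  · rw [hCs]
    refine ⟨hxd, ?_⟩
    rw [mem_preimage, ← hd0]
    exact e.map_source h0e
  · change A (e.symm (d x)) = 0
    rw [← hd0, e.left_inv h0e, map_zero]
  · intro v hv
    change d.symm (e (A.symm v)) = α (A.symm v)
    rw [hef]
    exact d.left_inv (heU (hCt v hv).1).2

end Slice

/-! ### Constancy of the transversal coordinate along the orbit -/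

section LinearAlgebra

/-- A linear map to `W × N` whose rank is at most `dim W` and whose image contains `W` has image
`W`. The rank bound comes from a factorisation through a map `L` of rank `dim W`. -/
theorem LinearMap.snd_eq_zero_of_finrank_range {E E₁ E₂ W N : Type*}
    [AddCommGroup E] [Module ℝ E] [AddCommGroup E₁] [Module ℝ E₁] [AddCommGroup E₂] [Module ℝ E₂]
    [AddCommGroup W] [Module ℝ W] [AddCommGroup N] [Module ℝ N] [FiniteDimensional ℝ E]
    [FiniteDimensional ℝ E₁]
    (A : E →ₗ[ℝ] E₁) (L : E₁ →ₗ[ℝ] E₂) (B : E₂ →ₗ[ℝ] W × N)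
    (hL : Module.finrank ℝ W = Module.finrank ℝ (LinearMap.range L))
    (T : W → E) (hT : ∀ w, B (L (A (T w))) = (w, 0)) (v : E) :
    (B (L (A v))).2 = 0 := by
  set D : E →ₗ[ℝ] W × N := B ∘ₗ L ∘ₗ A with hD
  have h1 : LinearMap.range (LinearMap.inl ℝ W N) ≤ LinearMap.range D := by
    rintro _ ⟨w, rfl⟩
    exact ⟨T w, hT w⟩
  have h2 : LinearMap.range D ≤ (LinearMap.range L).map B := by
    rintro _ ⟨w, rfl⟩
    exact ⟨L (A w), ⟨A w, rfl⟩, rfl⟩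
  have h3 : Module.finrank ℝ (LinearMap.range D) ≤
      Module.finrank ℝ (LinearMap.range (LinearMap.inl ℝ W N)) := by
    calc _ ≤ Module.finrank ℝ ((LinearMap.range L).map B) := Submodule.finrank_mono h2
      _ ≤ Module.finrank ℝ (LinearMap.range L) := Submodule.finrank_map_le _ _
      _ = Module.finrank ℝ W := hL.symm
      _ = _ := (LinearMap.finrank_range_of_inj LinearMap.inl_injective).symm
  have h4 := Submodule.eq_of_le_of_finrank_le h1 h3
  have h5 : D v ∈ LinearMap.range (LinearMap.inl ℝ W N) := h4 ▸ ⟨v, rfl⟩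
  obtain ⟨w, hw⟩ := h5
  change (D v).2 = 0
  rw [← hw]; rfl

end LinearAlgebra

namespace OrbitSlice

variable {E : Type*} [NormedAddCommGroup E] [NormedSpace ℝ E]
  {E' : Type*} [NormedAddCommGroup E'] [NormedSpace ℝ E']
  {G : Type*} [TopologicalSpace G] [ChartedSpace E G] [Group G]
  {X : Type*} [TopologicalSpace X] [ChartedSpace E' X] [MulAction G X]
  {x : X} {W N : Type*} [NormedAddCommGroup W] [NormedSpace ℝ W]
    [NormedAddCommGroup N] [NormedSpace ℝ N] (S : OrbitSlice E E' G x W N)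

/-- The coordinates of a slice chart, along the orbit and along the transversal. -/
def coord (y : X) : W × N := S.split (S.chart y)

theorem coord_base : S.coord x = 0 := by simp [coord, S.chart_base]

theorem contMDiffOn_coord : ContMDiffOn 𝓘(ℝ, E') 𝓘(ℝ, W × N) ∞ S.coord S.chart.source :=
  S.split.contDiff.contMDiff.comp_contMDiffOn (contMDiffOn_of_mem_maximalAtlas S.chart_mem)

theorem contMDiffOn_coord_fst :
    ContMDiffOn 𝓘(ℝ, E') 𝓘(ℝ, W) ∞ (fun y => (S.coord y).1) S.chart.source :=
  contDiff_fst.contMDiff.comp_contMDiffOn S.contMDiffOn_coord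

/-- The points of the slice chart in terms of their coordinates. -/
theorem sect_smul_trans {y : X} (hy : y ∈ S.chart.source) :
    S.sect (S.coord y).1 • S.transversal (S.coord y).2 = y := by
  have := S.symm_apply _ (S.chart.map_source hy)
  rw [S.chart.left_inv hy] at this
  exact this.symm

theorem coord_symm {w : W} {t : N} (h : S.split.symm (w, t) ∈ S.chart.target) :
    S.sect w • S.transversal t ∈ S.chart.source ∧ S.coord (S.sect w • S.transversal t) = (w, t) := by
  have h1 := S.symm_apply _ h
  rw [S.split.apply_symm_apply] at h1
  refine ⟨h1 ▸ S.chart.map_target h, ?_⟩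
  rw [coord, ← h1, S.chart.right_inv h, S.split.apply_symm_apply]

theorem mem_dom' {w : W} {t : N} (h : S.split.symm (w, t) ∈ S.chart.target) : w ∈ S.dom := by
  simpa using S.mem_dom _ h

theorem split_symm_coord_mem {y : X} (hy : y ∈ S.chart.source) :
    S.split.symm (S.coord y) ∈ S.chart.target := by
  simpa [coord] using S.chart.map_source hy

variable [LieGroup 𝓘(ℝ, E) ∞ G] [ContMDiffSMul 𝓘(ℝ, E) 𝓘(ℝ, E') ∞ G X]

omit [LieGroup 𝓘(ℝ, E) ∞ G] in
theorem isOpen_domain : IsOpen {g : G | g • x ∈ S.chart.source} :=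
  S.chart.open_source.preimage (contMDiff_smul_point E E' G x).continuous

omit [LieGroup 𝓘(ℝ, E) ∞ G] in
theorem contMDiffOn_coord_smul :
    ContMDiffOn 𝓘(ℝ, E) 𝓘(ℝ, W × N) ∞ (fun g : G => S.coord (g • x))
      {g : G | g • x ∈ S.chart.source} :=
  S.contMDiffOn_coord.comp (contMDiff_smul_point E E' G x).contMDiffOn fun _ h => h

/-- The differential of the orbital map, read in a slice chart, has image `W` at every point. By
equivariance its rank is that at `1`, namely `dim W`, and it contains `W` because moving along
`sect` changes only the first coordinate. -/
theorem mfderiv_coord_smul [FiniteDimensional ℝ E] {h : G} (hh : h • x ∈ S.chart.source) :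
    ∃ D : E →L[ℝ] W × N, HasMFDerivAt 𝓘(ℝ, E) 𝓘(ℝ, W × N) (fun g : G => S.coord (g • x)) h D ∧
      (∀ v, (D v).2 = 0) ∧ ∀ w, ∃ v, (D v).1 = w := by
  set F : G → W × N := fun g => S.coord (g • x) with hF
  have hFs : ContMDiffAt 𝓘(ℝ, E) 𝓘(ℝ, W × N) ∞ F h :=
    S.contMDiffOn_coord_smul.contMDiffAt (S.isOpen_domain.mem_nhds hh)
  let D : E →L[ℝ] W × N := mfderiv 𝓘(ℝ, E) 𝓘(ℝ, W × N) F h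
  have hD : HasMFDerivAt 𝓘(ℝ, E) 𝓘(ℝ, W × N) F h D :=
    (hFs.mdifferentiableAt (by simp)).hasMFDerivAt
  obtain ⟨T, hT⟩ : ∃ T : W →L[ℝ] E, ∀ w, D (T w) = (w, 0) := by
    set w₀ := (F h).1 with hw₀
    set t₀ := (F h).2 with ht₀
    let γ : W → G := fun w => S.sect w * ((S.sect w₀)⁻¹ * h)
    have hγ₀ : γ w₀ = h := by simp [γ]
    have hmem₀ : S.split.symm (w₀, t₀) ∈ S.chart.target := S.split_symm_coord_mem hh
    have hmem : ∀ᶠ w in 𝓝 w₀, S.split.symm (w, t₀) ∈ S.chart.target := by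
      have hc : Continuous fun w : W => S.split.symm (w, t₀) := by fun_prop
      exact hc.continuousAt.preimage_mem_nhds (S.chart.open_target.mem_nhds hmem₀)
    have hγ : ContMDiffAt 𝓘(ℝ, W) 𝓘(ℝ, E) ∞ γ w₀ := by
      have h1 : ContMDiffAt 𝓘(ℝ, W) 𝓘(ℝ, E) ∞ S.sect w₀ :=
        S.contMDiffOn_sect.contMDiffAt (S.isOpen_dom.mem_nhds (S.mem_dom' hmem₀))
      exact h1.mul contMDiffAt_const
    have hFγ : F ∘ γ =ᶠ[𝓝 w₀] fun w => (w, t₀) := by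
      filter_upwards [hmem] with w hw
      have h1 : h • x = S.sect w₀ • S.transversal t₀ := (S.sect_smul_trans hh).symm
      have h2 : γ w • x = S.sect w • S.transversal t₀ := by
        simp only [γ, mul_smul, h1, inv_smul_smul]
      simp only [Function.comp, F, h2]
      exact (S.coord_symm hw).2
    have hγd := (hγ.mdifferentiableAt (by simp)).hasMFDerivAt
    have hD' : HasMFDerivAt 𝓘(ℝ, E) 𝓘(ℝ, W × N) F (γ w₀) D := by rw [hγ₀]; exact hD
    let T : W →L[ℝ] E := mfderiv 𝓘(ℝ, W) 𝓘(ℝ, E) γ w₀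
    have h3 : HasFDerivAt (F ∘ γ) (D.comp T) w₀ :=
      hasMFDerivAt_iff_hasFDerivAt.1 (hD'.comp w₀ hγd)
    have h4 : HasFDerivAt (F ∘ γ) (ContinuousLinearMap.inl ℝ W N) w₀ := by
      refine HasFDerivAt.congr_of_eventuallyEq ?_ hFγ
      exact (hasFDerivAt_id w₀).prodMk (hasFDerivAt_const t₀ w₀)
    have h5 : D.comp T = ContinuousLinearMap.inl ℝ W N := h3.unique h4
    exact ⟨T, fun w => congrArg (fun T' : W →L[ℝ] W × N => T' w) h5⟩
  refine ⟨D, hD, ?_, fun w => ⟨T w, by rw [hT]⟩⟩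
  -- `F` is `g ↦ h⁻¹ * g`, then the orbital map at `1`, then translation by `h` in the slice chart.
  let a : G → G := fun g => h⁻¹ * g
  let φ : G → X := fun g => g • x
  let b : X → W × N := fun y => S.coord (h • y)
  have ha₀ : a h = 1 := by simp [a]
  have hφ₀ : φ 1 = x := by simp [φ]
  have ha : MDifferentiableAt 𝓘(ℝ, E) 𝓘(ℝ, E) a h :=
    (contMDiff_mul_left (I := 𝓘(ℝ, E)) (n := ∞) (a := h⁻¹) h).mdifferentiableAt (by simp)
  have hφ : MDifferentiableAt 𝓘(ℝ, E) 𝓘(ℝ, E') φ 1 :=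
    (contMDiff_smul_point E E' G x 1).mdifferentiableAt (by simp)
  have hb : MDifferentiableAt 𝓘(ℝ, E') 𝓘(ℝ, W × N) b x := by
    refine ContMDiffAt.mdifferentiableAt (n := ∞) ?_ (by simp)
    have h1 : ContMDiffAt 𝓘(ℝ, E') 𝓘(ℝ, W × N) ∞ S.coord (h • x) :=
      S.contMDiffOn_coord.contMDiffAt (S.chart.open_source.mem_nhds hh)
    exact h1.comp x (ContMDiffSMul.contMDiff_const_smul (I := 𝓘(ℝ, E)) h x)
  let A : E →L[ℝ] E := mfderiv 𝓘(ℝ, E) 𝓘(ℝ, E) a h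
  let B : E' →L[ℝ] W × N := mfderiv 𝓘(ℝ, E') 𝓘(ℝ, W × N) b x
  have hφ' : HasMFDerivAt 𝓘(ℝ, E) 𝓘(ℝ, E') φ (a h) (orbitDeriv E E' G x) := by
    rw [ha₀]; exact hφ.hasMFDerivAt
  have hb' : HasMFDerivAt 𝓘(ℝ, E') 𝓘(ℝ, W × N) b ((φ ∘ a) h) B := by
    have : (φ ∘ a) h = x := by simp [ha₀, hφ₀]
    rw [this]; exact hb.hasMFDerivAt
  have hcomp := hb'.comp h (hφ'.comp h ha.hasMFDerivAt)
  have hfun : b ∘ φ ∘ a = F := by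
    funext g
    simp [b, φ, a, F, mul_smul]
  rw [hfun] at hcomp
  have hDeq : ∀ v, D v = B (orbitDeriv E E' G x (A v)) := fun v =>
    congrArg (fun T : E →L[ℝ] W × N => T v) (hasMFDerivAt_unique hD hcomp)
  intro v
  rw [hDeq]
  exact LinearMap.snd_eq_zero_of_finrank_range (A : E →ₗ[ℝ] E)
    (orbitDeriv E E' G x : E →ₗ[ℝ] E') (B : E' →ₗ[ℝ] W × N) S.rank_eq T
    (fun w => (hDeq _).symm.trans (hT w)) v

/-- The transversal coordinate is locally constant along the orbit. -/
theorem eventually_coord_snd_eq [FiniteDimensional ℝ E] {h : G} (hh : h • x ∈ S.chart.source) :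
    ∀ᶠ g in 𝓝 h, (S.coord (g • x)).2 = (S.coord (h • x)).2 := by
  have : IsManifold 𝓘(ℝ, E) ∞ G := LieGroup.toContMDiffMul.toIsManifold
  refine ContMDiffOn.eventually_eq_of_mfderiv_eq_zero (f := fun g : G => (S.coord (g • x)).2)
    S.isOpen_domain (contDiff_snd.contMDiff.comp_contMDiffOn S.contMDiffOn_coord_smul) ?_ hh
  intro g hg
  obtain ⟨D, hD, hD0, -⟩ := S.mfderiv_coord_smul hg
  have h1 : HasMFDerivAt 𝓘(ℝ, W × N) 𝓘(ℝ, N) Prod.snd (S.coord (g • x))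
    (ContinuousLinearMap.snd ℝ W N) := hasFDerivAt_snd.hasMFDerivAt
  refine (h1.comp g hD).mfderiv.trans ?_
  ext v
  exact hD0 v

theorem surjective_mfderiv_coord_fst [FiniteDimensional ℝ E] {h : G}
    (hh : h • x ∈ S.chart.source) :
    Function.Surjective (mfderiv 𝓘(ℝ, E) 𝓘(ℝ, W) (fun g : G => (S.coord (g • x)).1) h) := by
  obtain ⟨D, hD, -, hDs⟩ := S.mfderiv_coord_smul hh
  have h1 : HasMFDerivAt 𝓘(ℝ, W × N) 𝓘(ℝ, W) Prod.fst (S.coord (h • x))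
    (ContinuousLinearMap.fst ℝ W N) := hasFDerivAt_fst.hasMFDerivAt
  have h2 := (h1.comp h hD).mfderiv
  change mfderiv 𝓘(ℝ, E) 𝓘(ℝ, W) (fun g : G => (S.coord (g • x)).1) h = _ at h2
  rw [h2]
  exact hDs

/-- The orbit of a separable group meets a transversal in a countable set. -/
theorem countable_coord_snd [FiniteDimensional ℝ E] [TopologicalSpace.SeparableSpace G] :
    ((fun g : G => (S.coord (g • x)).2) '' {g : G | g • x ∈ S.chart.source}).Countable := by
  obtain ⟨d, hdc, hd⟩ := TopologicalSpace.exists_countable_dense G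
  refine (hdc.image fun g : G => (S.coord (g • x)).2).mono ?_
  rintro _ ⟨g, hg, rfl⟩
  obtain ⟨U, hU, hUo, hgU⟩ := mem_nhds_iff.1 (S.eventually_coord_snd_eq hg)
  obtain ⟨g', hg'U, hg'd⟩ := hd.inter_open_nonempty U hUo ⟨g, hgU⟩
  exact ⟨g', hg'd, hU hg'U⟩

end OrbitSlice

/-! ### The smooth structure of the orbit -/

namespace OrbitSpace

variable {G : Type*} [Group G] {X : Type*} [MulAction G X] {x : X}

theorem surjective_orbitMap : Function.Surjective (orbitMap G x) := by
  rintro ⟨_, g, rfl⟩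
  exact ⟨g, rfl⟩

theorem injective_incl : Function.Injective (incl G x) := Subtype.val_injective

@[simp] theorem incl_orbitMap (g : G) : incl G x (orbitMap G x g) = g • x := rfl

variable [TopologicalSpace G]

/-- The topology of the orbit is the quotient topology along the orbital map. -/
theorem isQuotientMap_orbitMap : IsQuotientMap (orbitMap G x) := by
  refine ⟨⟨?_⟩, surjective_orbitMap⟩
  have h : orbitMap G x = equivQuotient G x ∘ QuotientGroup.mk :=
    funext fun g => (equivQuotient_mk G x g).symm
  rw [h, ← coinduced_compose]
  rfl

theorem continuous_incl (E E' : Type*) [NormedAddCommGroup E] [NormedSpace ℝ E] [ChartedSpace E G]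
    [NormedAddCommGroup E'] [NormedSpace ℝ E'] [TopologicalSpace X] [ChartedSpace E' X]
    [ContMDiffSMul 𝓘(ℝ, E) 𝓘(ℝ, E') ∞ G X] : Continuous (incl G x) :=
  isQuotientMap_orbitMap.continuous_iff.2 (contMDiff_smul_point E E' G x).continuous

end OrbitSpace

open OrbitSpace

namespace OrbitSlice

variable {E : Type*} [NormedAddCommGroup E] [NormedSpace ℝ E]
  {E' : Type*} [NormedAddCommGroup E'] [NormedSpace ℝ E']
  {G : Type*} [TopologicalSpace G] [ChartedSpace E G] [Group G]
  {X : Type*} [TopologicalSpace X] [ChartedSpace E' X] [MulAction G X]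
  {x : X} {W N : Type*} [NormedAddCommGroup W] [NormedSpace ℝ W]
    [NormedAddCommGroup N] [NormedSpace ℝ N] (S : OrbitSlice E E' G x W N)

theorem sect_smul_base {y : X} (hy : y ∈ S.chart.source) (hy0 : (S.coord y).2 = 0) :
    S.sect (S.coord y).1 • x = y := by
  have := S.sect_smul_trans hy
  rwa [hy0, S.transversal_zero] at this

theorem coord_sect_smul {w : W} (hw : S.split.symm (w, 0) ∈ S.chart.target) :
    S.sect w • x ∈ S.chart.source ∧ S.coord (S.sect w • x) = (w, 0) := by
  have := S.coord_symm hw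
  rwa [S.transversal_zero] at this

variable [LieGroup 𝓘(ℝ, E) ∞ G] [ContMDiffSMul 𝓘(ℝ, E) 𝓘(ℝ, E') ∞ G X] [FiniteDimensional ℝ E]

/-- The chart at `h x` of the orbit that is induced by a slice chart: its inverse is
`w ↦ h (sect w) x`, and it is the first coordinate of the slice chart translated by `h`. -/
noncomputable def orbitChart (h : G) : OpenPartialHomeomorph (OrbitSpace G x) W where
  toFun p := (S.coord (h⁻¹ • incl G x p)).1
  invFun w := orbitMap G x (h * S.sect w)
  source := {p | h⁻¹ • incl G x p ∈ S.chart.source ∧ (S.coord (h⁻¹ • incl G x p)).2 = 0}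
  target := {w | S.split.symm (w, 0) ∈ S.chart.target}
  map_source' p hp := by
    have := S.split_symm_coord_mem hp.1
    rwa [show S.coord (h⁻¹ • incl G x p) = ((S.coord (h⁻¹ • incl G x p)).1, 0) from
      Prod.ext rfl hp.2] at this
  map_target' w hw := by
    simpa [mul_smul, (S.coord_sect_smul hw).2] using (S.coord_sect_smul hw).1
  left_inv' p hp := by
    apply injective_incl
    rw [incl_orbitMap, mul_smul, S.sect_smul_base hp.1 hp.2, smul_inv_smul]
  right_inv' w hw := by
    simp [mul_smul, (S.coord_sect_smul hw).2]
  open_source := by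
    rw [← isQuotientMap_orbitMap.isOpen_preimage, isOpen_iff_mem_nhds]
    rintro g ⟨hg1, hg2⟩
    -- Openness in the quotient topology: the transversal coordinate is locally constant on `G`.
    rw [incl_orbitMap, ← mul_smul] at hg1 hg2
    have hc : ContinuousAt (fun g : G => h⁻¹ * g) g :=
      (contMDiff_mul_left (I := 𝓘(ℝ, E)) (n := ∞) (a := h⁻¹)).continuous.continuousAt
    filter_upwards [hc.preimage_mem_nhds (S.isOpen_domain.mem_nhds hg1),
      hc.eventually (S.eventually_coord_snd_eq hg1)] with g' h1 h2
    refine ⟨?_, ?_⟩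
    · rw [incl_orbitMap, ← mul_smul]; exact h1
    · rw [incl_orbitMap, ← mul_smul, h2, hg2]
  open_target := S.chart.open_target.preimage (by fun_prop)
  continuousOn_toFun := by
    have h1 : Continuous fun p : OrbitSpace G x => h⁻¹ • incl G x p :=
      (ContMDiffSMul.contMDiff_const_smul (I := 𝓘(ℝ, E)) (I' := 𝓘(ℝ, E')) (n := ∞)
        h⁻¹).continuous.comp (continuous_incl E E')
    exact S.contMDiffOn_coord_fst.continuousOn.comp h1.continuousOn fun p hp => hp.1
  continuousOn_invFun := by
    refine isQuotientMap_orbitMap.continuous.comp_continuousOn ?_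
    refine (contMDiff_mul_left (I := 𝓘(ℝ, E)) (n := ∞) (a := h)).continuous.comp_continuousOn ?_
    exact S.contMDiffOn_sect.continuousOn.mono fun w hw => S.mem_dom' hw

@[simp] theorem orbitChart_apply (h : G) (p : OrbitSpace G x) :
    S.orbitChart h p = (S.coord (h⁻¹ • incl G x p)).1 := rfl

@[simp] theorem orbitChart_symm_apply (h : G) (w : W) :
    (S.orbitChart h).symm w = orbitMap G x (h * S.sect w) := rfl

theorem mem_orbitChart_source (h : G) : orbitMap G x h ∈ (S.orbitChart h).source := by
  change _ ∧ _
  simp [S.mem_source, S.coord_base]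

/-- Read through the orbital map, the charts of the orbit are smooth. -/
theorem contMDiffOn_orbitChart_orbitMap (h : G) :
    ContMDiffOn 𝓘(ℝ, E) 𝓘(ℝ, W) ∞ (S.orbitChart h ∘ orbitMap G x)
      (orbitMap G x ⁻¹' (S.orbitChart h).source) :=
  S.contMDiffOn_coord_fst.comp ((ContMDiffSMul.contMDiff_const_smul (I := 𝓘(ℝ, E)) h⁻¹).comp
    (contMDiff_smul_point E E' G x)).contMDiffOn fun _ hg => hg.1

theorem contMDiffOn_mul_sect (h : G) :
    ContMDiffOn 𝓘(ℝ, W) 𝓘(ℝ, E) ∞ (fun w => h * S.sect w) (S.orbitChart h).target :=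
  (contMDiff_mul_left (I := 𝓘(ℝ, E)) (n := ∞) (a := h)).comp_contMDiffOn
    (S.contMDiffOn_sect.mono fun _ hw => S.mem_dom' hw)

theorem contDiffOn_orbitChart_trans (h h' : G) :
    ContDiffOn ℝ ∞ ((S.orbitChart h).symm.trans (S.orbitChart h'))
      ((S.orbitChart h).symm.trans (S.orbitChart h')).source := by
  rw [← contMDiffOn_iff_contDiffOn]
  refine (S.contMDiffOn_orbitChart_orbitMap h').comp
    ((S.contMDiffOn_mul_sect h).mono fun w hw => ?_) fun w hw => ?_
  · exact ((OpenPartialHomeomorph.trans_source _ _).subset hw).1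
  · exact ((OpenPartialHomeomorph.trans_source _ _).subset hw).2

/-- The smooth structure of the orbit, given by the charts of a slice and their translates. -/
noncomputable abbrev orbitChartedSpace : ChartedSpace W (OrbitSpace G x) where
  atlas := range S.orbitChart
  chartAt p := S.orbitChart (surjective_orbitMap p).choose
  mem_chart_source p := by
    have := S.mem_orbitChart_source (surjective_orbitMap p).choose
    rwa [(surjective_orbitMap p).choose_spec] at this
  chart_mem_atlas p := mem_range_self _

theorem isManifold_orbit :
    letI := S.orbitChartedSpace
    IsManifold 𝓘(ℝ, W) ∞ (OrbitSpace G x) := by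
  let _ := S.orbitChartedSpace
  refine isManifold_of_contDiffOn _ _ _ ?_
  rintro _ _ ⟨h, rfl⟩ ⟨h', rfl⟩
  simpa using S.contDiffOn_orbitChart_trans h h'

theorem isSubmersion_orbitMap [FiniteDimensional ℝ W] :
    letI := S.orbitChartedSpace
    Manifold.IsSubmersion 𝓘(ℝ, E) 𝓘(ℝ, W) ∞ (orbitMap G x) := by
  let _ := S.orbitChartedSpace
  have := S.isManifold_orbit
  have : IsManifold 𝓘(ℝ, E) ∞ G := LieGroup.toContMDiffMul.toIsManifold
  have hle : Module.finrank ℝ W ≤ Module.finrank ℝ E := by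
    rw [S.rank_eq]; exact LinearMap.finrank_range_le _
  refine Manifold.IsSubmersionOfComplement.isSubmersion
    (F := EuclideanSpace ℝ (Fin (Module.finrank ℝ E - Module.finrank ℝ W))) fun h => ?_
  have hU : IsOpen (orbitMap G x ⁻¹' (S.orbitChart h).source) :=
    (S.orbitChart h).open_source.preimage isQuotientMap_orbitMap.continuous
  have hsurj : Function.Surjective
      (mfderiv 𝓘(ℝ, E) 𝓘(ℝ, W) (S.orbitChart h ∘ orbitMap G x) h) := by
    have h1 : MDifferentiableAt 𝓘(ℝ, E) 𝓘(ℝ, W) (S.orbitChart h ∘ orbitMap G x) h :=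
      ((S.contMDiffOn_orbitChart_orbitMap h).contMDiffAt
        (hU.mem_nhds (S.mem_orbitChart_source h))).mdifferentiableAt (by simp)
    have hx1 : (1 : G) • x ∈ S.chart.source := by rw [one_smul]; exact S.mem_source
    -- Precomposing with `g ↦ h g` reduces surjectivity at `h` to surjectivity at `1`.
    have h2 : MDifferentiableAt 𝓘(ℝ, E) 𝓘(ℝ, E) (fun g : G => h * g) 1 :=
      (contMDiff_mul_left (I := 𝓘(ℝ, E)) (n := ∞) (a := h) 1).mdifferentiableAt (by simp)
    have h3 : (S.orbitChart h ∘ orbitMap G x) ∘ (fun g : G => h * g) =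
        fun g : G => (S.coord (g • x)).1 := by
      funext g; simp [mul_smul]
    have h4 := S.surjective_mfderiv_coord_fst hx1
    rw [← h3, mfderiv_comp_of_eq h1 h2 (mul_one h)] at h4
    have h5 : Function.Surjective
        (mfderiv 𝓘(ℝ, E) 𝓘(ℝ, W) (S.orbitChart h ∘ orbitMap G x) (h * 1)) := fun w =>
      (h4 w).imp' _ fun _ hv => hv
    rwa [mul_one] at h5
  obtain ⟨A, e, he, hhe, heU, hAe⟩ :=
    (S.contMDiffOn_orbitChart_orbitMap h).exists_chart_eq_fst
      (K := EuclideanSpace ℝ (Fin (Module.finrank ℝ E - Module.finrank ℝ W)))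
      (by simp; omega) hU (S.mem_orbitChart_source h) hsurj
  refine Manifold.IsSubmersionAtOfComplement.mk_of_charts A e (S.orbitChart h) hhe
    (S.mem_orbitChart_source h) he (IsManifold.subset_maximalAtlas (mem_range_self h)) heU ?_
  intro v hv
  have hv' : v ∈ e.target := by simpa using hv
  have := hAe _ (e.map_target hv')
  rw [e.right_inv hv'] at this
  simpa using this.symm

end OrbitSlice

/-! ### The orbit as a weakly embedded submanifold -/

namespace OrbitSlice

variable {E : Type*} [NormedAddCommGroup E] [NormedSpace ℝ E] [FiniteDimensional ℝ E]
  {E' : Type*} [NormedAddCommGroup E'] [NormedSpace ℝ E']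
  {G : Type*} [TopologicalSpace G] [ChartedSpace E G] [Group G] [LieGroup 𝓘(ℝ, E) ∞ G]
  {X : Type*} [TopologicalSpace X] [ChartedSpace E' X] [MulAction G X]
  [ContMDiffSMul 𝓘(ℝ, E) 𝓘(ℝ, E') ∞ G X]
  {x : X} {W N : Type*} [NormedAddCommGroup W] [NormedSpace ℝ W]
    [NormedAddCommGroup N] [NormedSpace ℝ N] (S : OrbitSlice E E' G x W N)
  {F : Type*} [NormedAddCommGroup F] [NormedSpace ℝ F] [ChartedSpace F (OrbitSpace G x)]
  (hO : IsOrbitStructure G x E F)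

include hO

/-- The charts of a slice are smooth for every smooth structure that makes the orbital map a
submersion. -/
theorem contMDiffOn_orbitChart (h : G) :
    ContMDiffOn 𝓘(ℝ, F) 𝓘(ℝ, W) ∞ (S.orbitChart h) (S.orbitChart h).source := by
  intro p hp
  obtain ⟨g, rfl⟩ := surjective_orbitMap p
  have hU : IsOpen (orbitMap G x ⁻¹' (S.orbitChart h).source) :=
    (S.orbitChart h).open_source.preimage isQuotientMap_orbitMap.continuous
  exact ((hO.isSubmersion.isSubmersionAt g).contMDiffAt_of_comp
    ((S.contMDiffOn_orbitChart_orbitMap h).contMDiffAt (hU.mem_nhds hp))).contMDiffWithinAt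

theorem contMDiffOn_orbitChart_symm (h : G) :
    ContMDiffOn 𝓘(ℝ, W) 𝓘(ℝ, F) ∞ (S.orbitChart h).symm (S.orbitChart h).target :=
  hO.isSubmersion.contMDiff.comp_contMDiffOn (S.contMDiffOn_mul_sect h)

include S in
/-- The dimension of the orbit is determined by its smooth structure. -/
theorem finrank_eq : Module.finrank ℝ F = Module.finrank ℝ W := by
  have h : (S.orbitChart 1).MDifferentiable 𝓘(ℝ, F) 𝓘(ℝ, W) :=
    ⟨(S.contMDiffOn_orbitChart hO 1).mdifferentiableOn (by simp),
      (S.contMDiffOn_orbitChart_symm hO 1).mdifferentiableOn (by simp)⟩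
  exact (h.mfderiv (S.mem_orbitChart_source 1)).toLinearEquiv.finrank_eq

omit [FiniteDimensional ℝ E] [LieGroup 𝓘(ℝ, E) ∞ G] hO in
/-- A slice chart, translated by `h`. -/
theorem smul_trans_chart_mem [IsManifold 𝓘(ℝ, E') ∞ X] (h : G) :
    (Diffeomorph.smul (M := X) 𝓘(ℝ, E) 𝓘(ℝ, E') ∞ h⁻¹).toHomeomorph.toOpenPartialHomeomorph.trans
      S.chart ∈ IsManifold.maximalAtlas 𝓘(ℝ, E') ∞ X := by
  apply OpenPartialHomeomorph.mem_maximalAtlas_of_contMDiffOn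
  · exact (contMDiffOn_of_mem_maximalAtlas S.chart_mem).comp
      (Diffeomorph.smul 𝓘(ℝ, E) 𝓘(ℝ, E') ∞ h⁻¹).contMDiff.contMDiffOn fun y hy => by simpa using hy
  · exact (Diffeomorph.smul 𝓘(ℝ, E) 𝓘(ℝ, E') ∞ h⁻¹).symm.contMDiff.comp_contMDiffOn
      ((contMDiffOn_symm_of_mem_maximalAtlas S.chart_mem).mono fun v hv => by simpa using hv)

end OrbitSlice

namespace OrbitSlice

variable {E : Type*} [NormedAddCommGroup E] [NormedSpace ℝ E] [FiniteDimensional ℝ E]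
  {E' : Type*} [NormedAddCommGroup E'] [NormedSpace ℝ E']
  {G : Type*} [TopologicalSpace G] [ChartedSpace E G] [Group G] [LieGroup 𝓘(ℝ, E) ∞ G]
  {X : Type*} [TopologicalSpace X] [ChartedSpace E' X] [MulAction G X]
  [ContMDiffSMul 𝓘(ℝ, E) 𝓘(ℝ, E') ∞ G X]
  {x : X} {W N : Type*} [NormedAddCommGroup W] [NormedSpace ℝ W]
    [NormedAddCommGroup N] [NormedSpace ℝ N] (S : OrbitSlice E E' G x W N)
  [ChartedSpace W (OrbitSpace G x)] (hO : IsOrbitStructure G x E W)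

include S hO

/-- In the charts of a slice the inclusion of the orbit is `w ↦ (w, 0)`. -/
theorem isImmersion_incl [IsManifold 𝓘(ℝ, E') ∞ X] :
    Manifold.IsImmersion 𝓘(ℝ, W) 𝓘(ℝ, E') ∞ (incl G x) := by
  have := hO.isManifold
  refine Manifold.IsImmersionOfComplement.isImmersion (F := N) fun p => ?_
  obtain ⟨h, rfl⟩ := surjective_orbitMap p
  refine Manifold.IsImmersionAtOfComplement.mk_of_charts S.split.symm (S.orbitChart h) _
    (S.mem_orbitChart_source h) ?_ ?_ (S.smul_trans_chart_mem h) ?_ ?_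
  · simp [S.mem_source]
  · exact OpenPartialHomeomorph.mem_maximalAtlas_of_contMDiffOn _ (S.contMDiffOn_orbitChart hO h)
      (S.contMDiffOn_orbitChart_symm hO h)
  · intro p hp
    simpa using hp.1
  · intro w hw
    have hw' : w ∈ (S.orbitChart h).target := by simpa using hw
    have h1 := congrArg S.split.symm (S.coord_sect_smul hw').2
    simpa [mul_smul, coord] using h1

/-- A smooth map into `X` with values in the orbit is smooth into the orbit. Its transversal
coordinate in a slice chart is continuous with values in a countable set, hence locally constant. -/
theorem contMDiff_of_incl_comp [TopologicalSpace.SeparableSpace G]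
    {V : Type*} [NormedAddCommGroup V] [NormedSpace ℝ V]
    {Q : Type*} [TopologicalSpace Q] [ChartedSpace V Q] {f : Q → OrbitSpace G x}
    (hf : ContMDiff 𝓘(ℝ, V) 𝓘(ℝ, E') ∞ (incl G x ∘ f)) : ContMDiff 𝓘(ℝ, V) 𝓘(ℝ, W) ∞ f := by
  intro q
  obtain ⟨k, hk⟩ := surjective_orbitMap (f q)
  have : LocallyConnectedSpace Q := ChartedSpace.locallyConnectedSpace V Q
  let a : Q → X := fun s => k⁻¹ • incl G x (f s)
  have ha : ContMDiff 𝓘(ℝ, V) 𝓘(ℝ, E') ∞ a :=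
    (ContMDiffSMul.contMDiff_const_smul (I := 𝓘(ℝ, E)) k⁻¹).comp hf
  have haq : a q = x := by simp [a, ← hk]
  set O : Set Q := a ⁻¹' S.chart.source
  have hO' : IsOpen O := S.chart.open_source.preimage ha.continuous
  have hqO : q ∈ O := by simpa [O, haq] using S.mem_source
  have hconst : ∀ s ∈ connectedComponentIn O q, (S.coord (a s)).2 = 0 := by
    intro s hs
    have hcont : ContinuousOn (fun s => (S.coord (a s)).2) (connectedComponentIn O q) :=
      continuous_snd.comp_continuousOn (S.contMDiffOn_coord.continuousOn.comp
        ha.continuous.continuousOn fun s hs => connectedComponentIn_subset O q hs)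
    have hsub : (fun s => (S.coord (a s)).2) '' connectedComponentIn O q ⊆
        (fun g : G => (S.coord (g • x)).2) '' {g : G | g • x ∈ S.chart.source} := by
      rintro _ ⟨s, hs, rfl⟩
      obtain ⟨g, hg⟩ := surjective_orbitMap (f s)
      have has : a s = (k⁻¹ * g) • x := by simp [a, ← hg, mul_smul]
      refine ⟨k⁻¹ * g, ?_, by simp only [has]⟩
      have := connectedComponentIn_subset O q hs
      rwa [mem_ofPred_eq, ← has]
    have h1 := S.countable_coord_snd.isTotallyDisconnected _ hsub
      (isPreconnected_connectedComponentIn.image _ hcont)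
      (mem_image_of_mem _ hs) (mem_image_of_mem _ (mem_connectedComponentIn hqO))
    simpa [haq, S.coord_base] using h1
  have hsm : ContMDiffAt 𝓘(ℝ, V) 𝓘(ℝ, W) ∞ (fun s => (S.coord (a s)).1) q :=
    ((S.contMDiffOn_coord_fst.comp ha.contMDiffOn fun _ h => h).contMDiffAt
      (hO'.mem_nhds hqO))
  have hmem : (S.coord (a q)).1 ∈ (S.orbitChart k).target := by
    have := (S.orbitChart k).map_source (S.mem_orbitChart_source k)
    rwa [hk] at this
  have h2 : ContMDiffAt 𝓘(ℝ, V) 𝓘(ℝ, W) ∞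
      ((S.orbitChart k).symm ∘ fun s => (S.coord (a s)).1) q :=
    ((S.contMDiffOn_orbitChart_symm hO k).contMDiffAt
      ((S.orbitChart k).open_target.mem_nhds hmem)).comp q hsm
  refine h2.congr_of_eventuallyEq ?_
  filter_upwards [hO'.connectedComponentIn.mem_nhds (mem_connectedComponentIn hqO)] with s hs
  exact ((S.orbitChart k).left_inv ⟨connectedComponentIn_subset O q hs, hconst s hs⟩).symm

theorem isWeaklyEmbedded_incl [IsManifold 𝓘(ℝ, E') ∞ X] [TopologicalSpace.SeparableSpace G] :
    IsWeaklyEmbedded.{u, v} W E' (incl G x) where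
  injective := injective_incl
  isImmersion := S.isImmersion_incl hO
  lift g hg hgr := by
    choose f hf using hgr
    have hfg : incl G x ∘ f = g := funext hf
    exact ⟨f, hfg, S.contMDiff_of_incl_comp hO (hfg ▸ hg)⟩

end OrbitSlice

theorem corollary3
    {E : Type*} [NormedAddCommGroup E] [NormedSpace ℝ E] [FiniteDimensional ℝ E]
    {G : Type*} [TopologicalSpace G] [ChartedSpace E G] [Group G] [LieGroup 𝓘(ℝ, E) ∞ G]
    [TopologicalSpace.SeparableSpace G]
    {E' : Type*} [NormedAddCommGroup E'] [NormedSpace ℝ E'] [FiniteDimensional ℝ E']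
    {X : Type*} [TopologicalSpace X] [ChartedSpace E' X] [IsManifold 𝓘(ℝ, E') ∞ X]
    [MulAction G X] [ContMDiffSMul 𝓘(ℝ, E) 𝓘(ℝ, E') ∞ G X] (x : X) :
    (∃ (r : ℕ) (_ : ChartedSpace (EuclideanSpace ℝ (Fin r)) (OrbitSpace G x)),
      IsOrbitStructure G x E (EuclideanSpace ℝ (Fin r))) ∧
    ∀ (r : ℕ) [ChartedSpace (EuclideanSpace ℝ (Fin r)) (OrbitSpace G x)],
      IsOrbitStructure G x E (EuclideanSpace ℝ (Fin r)) →
        IsWeaklyEmbedded.{u, v} (EuclideanSpace ℝ (Fin r)) E' (OrbitSpace.incl G x) := by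
  obtain ⟨r, hr⟩ : ∃ r, r = Module.finrank ℝ (orbitDeriv E E' G x).range := ⟨_, rfl⟩
  obtain ⟨N, ⟨S⟩⟩ := exists_orbitSlice E E' G x (EuclideanSpace ℝ (Fin r)) (by simpa using hr)
  refine ⟨⟨r, S.orbitChartedSpace, ?_⟩, ?_⟩
  · let _ := S.orbitChartedSpace
    exact ⟨S.isManifold_orbit, S.isSubmersion_orbitMap⟩
  intro r' _ hO
  obtain rfl : r' = r := by simpa using S.finrank_eq hO
  exact S.isWeaklyEmbedded_incl hO
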